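/- Let $\mathcal S^d_+$ denote the set of real symmetric positive semidefinite $d\times d$ matrices and let $\langle A,B\rangle=\operatorname{tr}(BA)$ be the trace inner product. A real $n\times n$ matrix $M$ is called completely positive semidefinite (cpsd) if there are $d\ge 1$ and $A_1,\dots,A_n\in\mathcal S^d_+$ with $M=(\langle A_i,A_j\rangle)_{i,j=1}^n$; the smallest $d\ge 1$ for which this is possible is called the cpsd-rank of $M$. Theorem. Let $n,d\ge 1$, let $A_1,\dots,A_n\in\mathcal S^d_+$, and let $M=(\langle A_i,A_j\rangle)_{i,j=1}^n$. Set $\ell=\max_i\operatorname{tr}(A_i)$ and $L=\max_i M_{ii}$. Then for every $0<\varepsilon<\frac12\min\{\ell^2,L\}$ there exists a cpsd $n\times n$ matrix $N$ with $$\text{cpsd-rank}(N)\le\min\left\{n\left\lceil\frac{9L\ell^2}{2\varepsilon^2}\right\rceil,\ \frac{(6\ell)^4\log\left(n\left\lceil\frac{18L\ell^2}{\varepsilon^2}\right\rceil+1\right)}{\varepsilon^2}\right\}$$ and $$|M_{ij}-N_{ij}|<\varepsilon\quad\text{for all } i,j\in\{1,\dots,n\},$$ where $\log$ is the natural logarithm.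 -/

import Mathlib

/-- The trace inner product `⟨A, B⟩ = tr (B A)` of real `d × d` matrices. -/
def traceInner {d : ℕ} (A B : Matrix (Fin d) (Fin d) ℝ) : ℝ :=
  (B * A).trace

/-- The matrices `A₁, …, Aₙ` form a Gram representation of `M` by real symmetric positive
semidefinite `d × d` matrices: each `Aᵢ` is psd, and `Mᵢⱼ = ⟨Aᵢ, Aⱼ⟩` for all `i, j`.
(For real matrices `Matrix.PosSemidef` includes symmetry.) -/
def IsPsdGramRep {n d : ℕ} (M : Matrix (Fin n) (Fin n) ℝ)
    (A : Fin n → Matrix (Fin d) (Fin d) ℝ) : Prop :=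
  (∀ i, (A i).PosSemidef) ∧ ∀ i j, M i j = traceInner (A i) (A j)

/-- `M` is completely positive semidefinite: it has a Gram representation by psd matrices of
some size `d ≥ 1`. -/
def IsCpsd {n : ℕ} (M : Matrix (Fin n) (Fin n) ℝ) : Prop :=
  ∃ d : ℕ, 1 ≤ d ∧ ∃ A : Fin n → Matrix (Fin d) (Fin d) ℝ, IsPsdGramRep M A

/-- The cpsd-rank of a cpsd matrix `M`: the smallest `d ≥ 1` such that `M` has a Gram
representation by psd matrices of size `d`. (Only meaningful when `IsCpsd M` holds.) -/
noncomputable def cpsdRank {n : ℕ} (M : Matrix (Fin n) (Fin n) ℝ) : ℕ :=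
  sInf {d : ℕ | 1 ≤ d ∧ ∃ A : Fin n → Matrix (Fin d) (Fin d) ℝ, IsPsdGramRep M A}

/-! Write `A i = ∑ a, c i a • u u^T` with orthonormal eigenvectors `u i a`. Then `M i j = ∑ a b, c i
a * c j b * ⟨u i a, u j b⟩ ^ 2`, so only eigenvalues and inner products of eigenvectors matter, and
any vectors with nearly the same inner products give a nearby Gram matrix of psd matrices.

Truncation: at most `k` eigenvalues of `A i` exceed `ℓ / k`, and the others have sum of squares at
most `ℓ ^ 2 / k`. The weights `⟨u i a, u j b⟩ ^ 2` are doubly stochastic by Parseval, so a weighted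
Cauchy–Schwarz inequality bounds the effect of dropping the small eigenvalues by `2 √(L ℓ ^ 2 / k)`
(`abs_sum_sum_sub_sum_sum_lt`).

At most `n * k` unit vectors remain. Moving them isometrically to dimension `n * k` gives the first
bound. A Johnson–Lindenstrauss projection (`exists_dotProduct_approx`) gives the logarithmic one.
The projection uses random signs: `sum_signVectors_exp_mul_le` bounds the moment generating function
of `⟨s, u⟩ ⟨s, v⟩`, and `exists_sum_exp_le` picks the signs greedily. -/

/-! ### Spectral decompositions, Gram vectors and weighted Cauchy–Schwarz -/

open scoped Matrix in
/-- A spectral decomposition of a psd matrix into rank-one matrices. -/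
theorem Matrix.PosSemidef.exists_eq_sum_vecMulVec {d : ℕ} {A : Matrix (Fin d) (Fin d) ℝ}
    (hA : A.PosSemidef) :
    ∃ (c : Fin d → ℝ) (u : Fin d → Fin d → ℝ), (∀ a, 0 ≤ c a) ∧ (∀ a, u a ⬝ᵥ u a = 1) ∧
      (∀ x, ∑ a, (u a ⬝ᵥ x) ^ 2 = x ⬝ᵥ x) ∧ A = ∑ a, c a • Matrix.vecMulVec (u a) (u a) := by
  set U : Matrix (Fin d) (Fin d) ℝ := (hA.1.eigenvectorUnitary : Matrix (Fin d) (Fin d) ℝ) with hU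
  have h1 : Uᵀ * U = 1 := by
    have := Unitary.coe_star_mul_self hA.1.eigenvectorUnitary
    simpa [Matrix.star_eq_conjTranspose] using this
  have h2 : U * Uᵀ = 1 := mul_eq_one_comm.1 h1
  refine ⟨hA.1.eigenvalues, Uᵀ, hA.eigenvalues_nonneg, fun a => ?_, fun x => ?_, ?_⟩
  · have := congrFun (congrFun h1 a) a
    simpa [Matrix.mul_apply, dotProduct] using this
  · have h3 : (Uᵀ.mulVec x) ⬝ᵥ (Uᵀ.mulVec x) = x ⬝ᵥ x := by
      rw [Matrix.dotProduct_mulVec, Matrix.vecMul_transpose, Matrix.mulVec_mulVec, h2,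
        Matrix.one_mulVec]
    rw [← h3]
    simp only [dotProduct, Matrix.mulVec, sq]
  · have h3 := hA.1.spectral_theorem
    rw [Unitary.conjStarAlgAut_apply] at h3
    ext i j
    conv_lhs => rw [h3]
    rw [Matrix.mul_apply, Matrix.sum_apply]
    refine Finset.sum_congr rfl fun a _ => ?_
    simp [Matrix.vecMulVec_apply, Matrix.mul_diagonal, hU]
    ring

theorem posSemidef_sum_smul_vecMulVec {α : Type*} {D : ℕ} (s : Finset α) {c : α → ℝ}
    (hc : ∀ a, 0 ≤ c a) (w : α → Fin D → ℝ) :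
    (∑ a ∈ s, c a • Matrix.vecMulVec (w a) (w a)).PosSemidef := by
  refine Matrix.posSemidef_sum s fun a _ => Matrix.PosSemidef.smul ?_ (hc a)
  simpa using Matrix.posSemidef_vecMulVec_self_star (w a)

theorem traceInner_sum_smul_vecMulVec {α β : Type*} {D : ℕ} (s : Finset α) (t : Finset β)
    (c : α → ℝ) (e : β → ℝ) (w : α → Fin D → ℝ) (z : β → Fin D → ℝ) :
    traceInner (∑ a ∈ s, c a • Matrix.vecMulVec (w a) (w a))
        (∑ b ∈ t, e b • Matrix.vecMulVec (z b) (z b)) =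
      ∑ a ∈ s, ∑ b ∈ t, c a * e b * (w a ⬝ᵥ z b) ^ 2 := by
  rw [traceInner, Finset.sum_mul_sum, Finset.sum_comm, Matrix.trace_sum]
  refine Finset.sum_congr rfl fun a _ => ?_
  rw [Matrix.trace_sum]
  refine Finset.sum_congr rfl fun b _ => ?_
  rw [smul_mul_smul_comm, Matrix.vecMulVec_mul_vecMulVec, Matrix.trace_smul,
    Matrix.trace_vecMulVec, dotProduct_smul, dotProduct_comm (z b) (w a)]
  simp only [smul_eq_mul]
  ring

theorem trace_sum_smul_vecMulVec {α : Type*} {D : ℕ} (s : Finset α) (c : α → ℝ)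
    {w : α → Fin D → ℝ} (hw : ∀ a, w a ⬝ᵥ w a = 1) :
    (∑ a ∈ s, c a • Matrix.vecMulVec (w a) (w a)).trace = ∑ a ∈ s, c a := by
  simp [Matrix.trace_sum, Matrix.trace_vecMulVec, hw]

open scoped Matrix in
/-- Finitely many vectors can be moved to a space of dimension their number, keeping all
inner products. -/
theorem exists_dotProduct_eq {ι : Type*} [Fintype ι] {d D : ℕ} (v : ι → Fin d → ℝ)
    (hD : Fintype.card ι ≤ D) :
    ∃ w : ι → Fin D → ℝ, ∀ p q, w p ⬝ᵥ w q = v p ⬝ᵥ v q := by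
  set e := Fintype.equivFin ι
  set N := Fintype.card ι
  set V : Matrix (Fin N) (Fin d) ℝ := Matrix.of fun x => v (e.symm x)
  have hG : (V * Vᵀ).PosSemidef := by
    simpa using Matrix.posSemidef_self_mul_conjTranspose V
  obtain ⟨c, u, hc, -, -, h⟩ := hG.exists_eq_sum_vecMulVec
  have hinj := Fin.castLE_injective hD
  -- The rows of a square root factor of the Gram matrix, padded with zeros up to dimension `D`.
  refine ⟨fun p => Function.extend (Fin.castLE hD) (fun a => √(c a) * u a (e p)) 0,
    fun p q => ?_⟩
  have h1 := congrFun (congrFun h (e p)) (e q)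
  have h2 : (V * Vᵀ) (e p) (e q) = v p ⬝ᵥ v q := by
    simp [V, Matrix.mul_apply, dotProduct]
  rw [← h2, h1, Matrix.sum_apply, dotProduct]
  symm
  refine Fintype.sum_of_injective (Fin.castLE hD) hinj _ _ (fun x hx => ?_) fun a => ?_
  · beta_reduce
    rw [Function.extend_apply' _ _ _ hx, Pi.zero_apply, zero_mul]
  · beta_reduce
    rw [hinj.extend_apply, hinj.extend_apply, mul_mul_mul_comm, Real.mul_self_sqrt (hc a),
      Matrix.smul_apply, Matrix.vecMulVec_apply, smul_eq_mul]

/-- A Cauchy–Schwarz inequality for doubly substochastic weights. -/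
theorem sq_sum_sum_mul_le {α β : Type*} {s : Finset α} {t : Finset β} {x : α → ℝ} {y : β → ℝ}
    {c : α → β → ℝ} (hc : ∀ a b, 0 ≤ c a b) (hrow : ∀ a ∈ s, ∑ b ∈ t, c a b ≤ 1)
    (hcol : ∀ b ∈ t, ∑ a ∈ s, c a b ≤ 1) :
    (∑ a ∈ s, ∑ b ∈ t, x a * y b * c a b) ^ 2 ≤ (∑ a ∈ s, x a ^ 2) * ∑ b ∈ t, y b ^ 2 := by
  have h := Finset.sum_mul_sq_le_sq_mul_sq (s ×ˢ t) (fun p => x p.1 * √(c p.1 p.2))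
    (fun p => y p.2 * √(c p.1 p.2))
  have e1 : ∑ p ∈ s ×ˢ t, x p.1 * √(c p.1 p.2) * (y p.2 * √(c p.1 p.2)) =
      ∑ a ∈ s, ∑ b ∈ t, x a * y b * c a b := by
    rw [Finset.sum_product]
    refine Finset.sum_congr rfl fun a _ => Finset.sum_congr rfl fun b _ => ?_
    rw [mul_mul_mul_comm, Real.mul_self_sqrt (hc a b)]
  have e2 : ∑ p ∈ s ×ˢ t, (x p.1 * √(c p.1 p.2)) ^ 2 ≤ ∑ a ∈ s, x a ^ 2 := by
    rw [Finset.sum_product]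
    refine Finset.sum_le_sum fun a ha => ?_
    simp only [mul_pow, Real.sq_sqrt (hc _ _)]
    rw [← Finset.mul_sum]
    exact mul_le_of_le_one_right (sq_nonneg _) (hrow a ha)
  have e3 : ∑ p ∈ s ×ˢ t, (y p.2 * √(c p.1 p.2)) ^ 2 ≤ ∑ b ∈ t, y b ^ 2 := by
    rw [Finset.sum_product_right]
    refine Finset.sum_le_sum fun b hb => ?_
    simp only [mul_pow, Real.sq_sqrt (hc _ _)]
    rw [← Finset.mul_sum]
    exact mul_le_of_le_one_right (sq_nonneg _) (hcol b hb)
  rw [e1] at h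
  exact h.trans (mul_le_mul e2 e3 (Finset.sum_nonneg fun _ _ => sq_nonneg _)
    (Finset.sum_nonneg fun _ _ => sq_nonneg _))

/-! ### Exponential moments of random signs -/

open MeasureTheory in
/-- The Gaussian integral with a linear term. -/
theorem integrable_and_integral_exp_neg_half_sq_add_mul (b : ℝ) :
    Integrable (fun h : ℝ => Real.exp (-(1 / 2) * h ^ 2 + b * h)) ∧
      ∫ h : ℝ, Real.exp (-(1 / 2) * h ^ 2 + b * h) =
        Real.exp (b ^ 2 / 2) * √(2 * Real.pi) := by
  have key : (fun h : ℝ => Real.exp (-(1 / 2) * h ^ 2 + b * h)) =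
      fun h : ℝ => Real.exp (b ^ 2 / 2) * Real.exp (-(1 / 2) * (h - b) ^ 2) := by
    funext h
    rw [← Real.exp_add]
    congr 1
    ring
  rw [key]
  constructor
  · exact ((integrable_exp_neg_mul_sq (by norm_num : (0 : ℝ) < 1 / 2)).comp_sub_right b).const_mul _
  · rw [integral_const_mul, integral_sub_right_eq_self (fun h : ℝ => Real.exp (-(1 / 2) * h ^ 2)),
      integral_gaussian]
    congr 2
    ring

/-- For `z ≥ 0`, `exp (-x) * (1 + x) + x ^ 2 / 2` increases from its value `1` at `0`. For `z ≤ 0`,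
even `1 + z + z ^ 2 / 2` suffices, since `(1 + z + z ^ 2 / 2) * (1 - z + z ^ 2 / 2) = 1 + z ^ 4 /
4`. -/
theorem Real.exp_le_one_add_add_sq_half_mul_exp_abs (z : ℝ) :
    Real.exp z ≤ 1 + z + z ^ 2 / 2 * Real.exp |z| := by
  rcases le_total 0 z with hz | hz
  · rw [abs_of_nonneg hz]
    have hd : ∀ x : ℝ, HasDerivAt (fun x : ℝ => Real.exp (-x) * (1 + x) + x ^ 2 / 2)
        (x * (1 - Real.exp (-x))) x := by
      intro x
      have h1 : HasDerivAt (fun x : ℝ => Real.exp (-x)) (Real.exp (-x) * (-1)) x :=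
        (hasDerivAt_neg x).exp
      have h2 : HasDerivAt (fun x : ℝ => 1 + x) 1 x := (hasDerivAt_id x).const_add 1
      have h3 : HasDerivAt (fun x : ℝ => x ^ 2 / 2) x x :=
        ((hasDerivAt_pow 2 x).div_const 2).congr_deriv (by norm_num)
      exact ((h1.mul h2).add h3).congr_deriv (by ring)
    have hmono : MonotoneOn (fun x : ℝ => Real.exp (-x) * (1 + x) + x ^ 2 / 2) (Set.Ici 0) := by
      apply monotoneOn_of_deriv_nonneg (convex_Ici 0)
      · exact fun x _ => (hd x).continuousAt.continuousWithinAt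
      · exact fun x _ => (hd x).differentiableAt.differentiableWithinAt
      · intro x hx
        rw [interior_Ici, Set.mem_Ioi] at hx
        rw [(hd x).deriv]
        have : Real.exp (-x) ≤ 1 := Real.exp_le_one_iff.2 (by linarith)
        exact mul_nonneg hx.le (by linarith)
    have h := hmono (Set.mem_Ici.2 le_rfl) (Set.mem_Ici.2 hz) hz
    simp only [neg_zero, Real.exp_zero] at h
    have h' := mul_le_mul_of_nonneg_left h (Real.exp_pos z).le
    have he : Real.exp z * Real.exp (-z) = 1 := by rw [← Real.exp_add]; simp
    calc Real.exp z ≤ Real.exp z * (Real.exp (-z) * (1 + z) + z ^ 2 / 2) := by linarith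
      _ = (Real.exp z * Real.exp (-z)) * (1 + z) + z ^ 2 / 2 * Real.exp z := by ring
      _ = _ := by rw [he]; ring
  · have h1 : 1 + -z + (-z) ^ 2 / 2 ≤ Real.exp (-z) :=
      Real.quadratic_le_exp_of_nonneg (by linarith)
    have he : Real.exp z * Real.exp (-z) = 1 := by rw [← Real.exp_add]; simp
    have h2 : Real.exp z * (1 + -z + (-z) ^ 2 / 2) ≤ 1 :=
      (mul_le_mul_of_nonneg_left h1 (Real.exp_pos z).le).trans_eq he
    have h3 : Real.exp z ≤ 1 + z + z ^ 2 / 2 := by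
      have h4 : (1 : ℝ) ≤ (1 + z + z ^ 2 / 2) * (1 + -z + (-z) ^ 2 / 2) := by
        nlinarith [sq_nonneg (z ^ 2)]
      have h5 : 0 < 1 + -z + (-z) ^ 2 / 2 := by nlinarith [sq_nonneg z]
      exact le_of_mul_le_mul_right (h2.trans h4) h5
    have h6 : 1 ≤ Real.exp |z| := Real.one_le_exp (abs_nonneg z)
    nlinarith [sq_nonneg z]

/-- Square the tangent bound `e * x ≤ exp x` at `x = y / 6`; the constant is `36 / e ^ 2 < 5`. -/
theorem sq_le_five_mul_exp_div_three {y : ℝ} (hy : 0 ≤ y) : y ^ 2 ≤ 5 * Real.exp (y / 3) := by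
  have h1 : y / 6 * Real.exp 1 ≤ Real.exp (y / 6) := by
    have := Real.add_one_le_exp (y / 6 - 1)
    calc y / 6 * Real.exp 1 ≤ Real.exp (y / 6 - 1) * Real.exp 1 :=
          mul_le_mul_of_nonneg_right (by linarith) (Real.exp_pos 1).le
      _ = Real.exp (y / 6) := by rw [← Real.exp_add]; congr 1; ring
  have h2 : (y / 6 * Real.exp 1) ^ 2 ≤ Real.exp (y / 3) := by
    calc (y / 6 * Real.exp 1) ^ 2 ≤ Real.exp (y / 6) ^ 2 :=
          pow_le_pow_left₀ (by positivity) h1 2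
      _ = Real.exp (y / 3) := by rw [← Real.exp_nat_mul]; congr 1; push_cast; ring
  have h3 : (36 : ℝ) / 5 ≤ Real.exp 1 ^ 2 := by nlinarith [Real.exp_one_gt_d9]
  have h4 := mul_le_mul_of_nonneg_left h3 (sq_nonneg y)
  nlinarith

/-- The vectors of length `d` with entries `±1`. -/
noncomputable def signVectors (d : ℕ) : Finset (Fin d → ℝ) := Fintype.piFinset fun _ => {1, -1}

theorem card_signVectors (d : ℕ) : (signVectors d).card = 2 ^ d := by
  have h : ({1, -1} : Finset ℝ).card = 2 := Finset.card_pair (by norm_num)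
  simp [signVectors, Fintype.card_piFinset, h]

theorem sum_signVectors_prod {d : ℕ} (g : Fin d → ℝ → ℝ) :
    ∑ s ∈ signVectors d, ∏ i, g i (s i) = ∏ i, (g i 1 + g i (-1)) := by
  rw [signVectors, Finset.sum_prod_piFinset]
  refine Finset.prod_congr rfl fun i _ => ?_
  rw [Finset.sum_pair (by norm_num)]

theorem sum_signVectors_exp_dotProduct_le {d : ℕ} {u : Fin d → ℝ} (hu : u ⬝ᵥ u = 1) (a : ℝ) :
    ∑ s ∈ signVectors d, Real.exp (a * (s ⬝ᵥ u)) ≤ 2 ^ d * Real.exp (a ^ 2 / 2) := by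
  have h1 : ∀ s ∈ signVectors d, Real.exp (a * (s ⬝ᵥ u)) = ∏ i, Real.exp (a * (s i * u i)) := by
    intro s _
    rw [← Real.exp_sum, dotProduct, Finset.mul_sum]
  rw [Finset.sum_congr rfl h1, sum_signVectors_prod (fun i x => Real.exp (a * (x * u i)))]
  have h2 : ∀ i, Real.exp (a * (1 * u i)) + Real.exp (a * (-1 * u i)) ≤
      2 * Real.exp ((a * u i) ^ 2 / 2) := by
    intro i
    have := Real.cosh_le_exp_half_sq (a * u i)
    rw [Real.cosh_eq] at this
    have e1 : a * (1 * u i) = a * u i := by ring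
    have e2 : a * (-1 * u i) = -(a * u i) := by ring
    rw [e1, e2]
    linarith
  calc _ ≤ ∏ i : Fin d, 2 * Real.exp ((a * u i) ^ 2 / 2) :=
        Finset.prod_le_prod (fun i _ => by positivity) fun i _ => h2 i
    _ = 2 ^ d * Real.exp (∑ i, (a * u i) ^ 2 / 2) := by
        rw [Finset.prod_mul_distrib, ← Real.exp_sum]; simp
    _ = 2 ^ d * Real.exp (a ^ 2 / 2) := by
        have : ∑ i, (a * u i) ^ 2 / 2 = a ^ 2 / 2 * (u ⬝ᵥ u) := by
          rw [dotProduct, Finset.mul_sum]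
          exact Finset.sum_congr rfl fun i _ => by ring
        rw [this, hu, mul_one]

-- Gaussian linearisation: `exp (a ^ 2 * x ^ 2 / 2)` is the mean of `exp (a * x * h)` over a
-- standard Gaussian `h`. With `a ^ 2 = 3 / 4`, averaging over signs first leaves the mean of `exp
-- (3 / 8 * h ^ 2)`, which is `1 / √(1 - 3 / 4) = 2`.
open MeasureTheory in
theorem sum_signVectors_exp_sq_dotProduct_le {d : ℕ} {u : Fin d → ℝ} (hu : u ⬝ᵥ u = 1) :
    ∑ s ∈ signVectors d, Real.exp (3 / 8 * (s ⬝ᵥ u) ^ 2) ≤ 2 ^ d * 2 := by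
  have hpi : 0 < √(2 * Real.pi) := by positivity
  have ha : (√3 / 2 : ℝ) ^ 2 = 3 / 4 := by
    rw [div_pow, Real.sq_sqrt (by norm_num)]; norm_num
  set a : ℝ := √3 / 2
  have hint := fun s : Fin d → ℝ =>
    integrable_and_integral_exp_neg_half_sq_add_mul (a * (s ⬝ᵥ u))
  have h1 : (∑ s ∈ signVectors d, Real.exp (3 / 8 * (s ⬝ᵥ u) ^ 2)) * √(2 * Real.pi) =
      ∫ h : ℝ, ∑ s ∈ signVectors d, Real.exp (-(1 / 2) * h ^ 2 + a * (s ⬝ᵥ u) * h) := by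
    rw [integral_finsetSum _ fun s _ => (hint s).1, Finset.sum_mul]
    refine Finset.sum_congr rfl fun s _ => ?_
    rw [(hint s).2, mul_pow, ha]
    congr 2
    ring
  have h2 : ∫ h : ℝ, ∑ s ∈ signVectors d, Real.exp (-(1 / 2) * h ^ 2 + a * (s ⬝ᵥ u) * h) ≤
      ∫ h : ℝ, 2 ^ d * Real.exp (-(1 / 8) * h ^ 2) := by
    apply integral_mono
    · exact integrable_finsetSum _ fun s _ => (hint s).1
    · exact (integrable_exp_neg_mul_sq (by norm_num)).const_mul _
    intro h
    have h3 := sum_signVectors_exp_dotProduct_le hu (a * h)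
    calc ∑ s ∈ signVectors d, Real.exp (-(1 / 2) * h ^ 2 + a * (s ⬝ᵥ u) * h)
        = Real.exp (-(1 / 2) * h ^ 2) * ∑ s ∈ signVectors d, Real.exp (a * h * (s ⬝ᵥ u)) := by
          rw [Finset.mul_sum]
          refine Finset.sum_congr rfl fun s _ => ?_
          rw [← Real.exp_add]
          congr 1
          ring
      _ ≤ Real.exp (-(1 / 2) * h ^ 2) * (2 ^ d * Real.exp ((a * h) ^ 2 / 2)) :=
          mul_le_mul_of_nonneg_left h3 (Real.exp_pos _).le
      _ = 2 ^ d * Real.exp (-(1 / 8) * h ^ 2) := by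
          rw [mul_left_comm, ← Real.exp_add, mul_pow, ha]
          congr 2
          ring
  have h4 : ∫ h : ℝ, 2 ^ d * Real.exp (-(1 / 8) * h ^ 2) = 2 ^ d * 2 * √(2 * Real.pi) := by
    rw [integral_const_mul, integral_gaussian]
    have : Real.pi / (1 / 8) = 2 ^ 2 * (2 * Real.pi) := by ring
    rw [this, Real.sqrt_mul (by norm_num), Real.sqrt_sq (by norm_num)]
    ring
  exact le_of_mul_le_mul_right (h1.trans_le (h2.trans_eq h4)) hpi

theorem sum_signVectors_mul {d : ℕ} (i j : Fin d) :
    ∑ s ∈ signVectors d, s i * s j = if i = j then 2 ^ d else 0 := by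
  split_ifs with hij
  · subst hij
    have h : ∀ s ∈ signVectors d, s i * s i = 1 := by
      intro s hs
      have := Fintype.mem_piFinset.1 hs i
      simp only [Finset.mem_insert, Finset.mem_singleton] at this
      rcases this with h | h <;> rw [h] <;> norm_num
    rw [Finset.sum_congr rfl h, Finset.sum_const, card_signVectors]
    simp
  · have h : ∀ s ∈ signVectors d, s i * s j =
        ∏ k, ((if k = i then s k else 1) * (if k = j then s k else 1)) := by
      intro s _
      rw [Finset.prod_mul_distrib]
      simp
    rw [Finset.sum_congr rfl h, sum_signVectors_prod
      (fun k x => (if k = i then x else 1) * (if k = j then x else 1))]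
    apply Finset.prod_eq_zero (Finset.mem_univ i)
    simp [hij]

theorem sum_signVectors_dotProduct_mul_dotProduct {d : ℕ} (u v : Fin d → ℝ) :
    ∑ s ∈ signVectors d, (s ⬝ᵥ u) * (s ⬝ᵥ v) = 2 ^ d * (u ⬝ᵥ v) := by
  have h : ∀ s ∈ signVectors d, (s ⬝ᵥ u) * (s ⬝ᵥ v) =
      ∑ i, ∑ j, u i * v j * (s i * s j) := by
    intro s _
    rw [dotProduct, dotProduct, Finset.sum_mul_sum]
    exact Finset.sum_congr rfl fun i _ => Finset.sum_congr rfl fun j _ => by ring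
  rw [Finset.sum_congr rfl h, Finset.sum_comm, dotProduct, Finset.mul_sum]
  refine Finset.sum_congr rfl fun i _ => ?_
  rw [Finset.sum_comm]
  simp_rw [← Finset.mul_sum, sum_signVectors_mul]
  simp
  ring

/-- Expand the exponential to second order: the linear term averages to `t * (u ⬝ᵥ v)`, and the
remainder is controlled by the exponential square moments. -/
theorem sum_signVectors_exp_mul_le {d : ℕ} {u v : Fin d → ℝ} (hu : u ⬝ᵥ u = 1) (hv : v ⬝ᵥ v = 1)
    {t : ℝ} (ht : |t| ≤ 1 / 24) :
    ∑ s ∈ signVectors d, Real.exp (t * ((s ⬝ᵥ u) * (s ⬝ᵥ v))) ≤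
      2 ^ d * Real.exp (t * (u ⬝ᵥ v) + 5 * t ^ 2) := by
  have hpt : ∀ s ∈ signVectors d, Real.exp (t * ((s ⬝ᵥ u) * (s ⬝ᵥ v))) ≤
      1 + t * ((s ⬝ᵥ u) * (s ⬝ᵥ v)) + 5 / 4 * t ^ 2 *
        (Real.exp (3 / 8 * (s ⬝ᵥ u) ^ 2) + Real.exp (3 / 8 * (s ⬝ᵥ v) ^ 2)) := by
    intro s _
    generalize s ⬝ᵥ u = x
    generalize s ⬝ᵥ v = y
    have h1 := Real.exp_le_one_add_add_sq_half_mul_exp_abs (t * (x * y))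
    have h2 := sq_le_five_mul_exp_div_three (abs_nonneg (x * y))
    have h3 : Real.exp |t * (x * y)| ≤ Real.exp (|x * y| / 24) := by
      apply Real.exp_le_exp.2
      rw [abs_mul]
      nlinarith [abs_nonneg (x * y)]
    -- The restriction on `t` is chosen so that `1 / 3 + 1 / 24 = 3 / 8`, the available exponent.
    have h4 : Real.exp (|x * y| / 3) * Real.exp (|x * y| / 24) ≤
        (Real.exp (3 / 8 * x ^ 2) + Real.exp (3 / 8 * y ^ 2)) / 2 := by
      have hxy : |x * y| ≤ (x ^ 2 + y ^ 2) / 2 := by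
        rw [abs_mul]
        nlinarith [sq_nonneg (|x| - |y|), sq_abs x, sq_abs y]
      calc Real.exp (|x * y| / 3) * Real.exp (|x * y| / 24)
          ≤ Real.exp (3 / 16 * x ^ 2) * Real.exp (3 / 16 * y ^ 2) := by
            rw [← Real.exp_add, ← Real.exp_add]
            apply Real.exp_le_exp.2
            linarith
        _ ≤ (Real.exp (3 / 16 * x ^ 2) ^ 2 + Real.exp (3 / 16 * y ^ 2) ^ 2) / 2 := by
            nlinarith [sq_nonneg (Real.exp (3 / 16 * x ^ 2) - Real.exp (3 / 16 * y ^ 2))]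
        _ = _ := by
            rw [← Real.exp_nat_mul, ← Real.exp_nat_mul]
            congr 3 <;> push_cast <;> ring
    have h5 : (x * y) ^ 2 * Real.exp |t * (x * y)| ≤
        5 * ((Real.exp (3 / 8 * x ^ 2) + Real.exp (3 / 8 * y ^ 2)) / 2) := by
      rw [← sq_abs (x * y)]
      calc |x * y| ^ 2 * Real.exp |t * (x * y)|
          ≤ (5 * Real.exp (|x * y| / 3)) * Real.exp (|x * y| / 24) :=
            mul_le_mul h2 h3 (Real.exp_pos _).le (by positivity)
        _ ≤ _ := by rw [mul_assoc]; linarith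
    have h6 := mul_le_mul_of_nonneg_left h5 (by positivity : 0 ≤ t ^ 2 / 2)
    nlinarith
  have hU := sum_signVectors_exp_sq_dotProduct_le hu
  have hV := sum_signVectors_exp_sq_dotProduct_le hv
  calc _ ≤ ∑ s ∈ signVectors d, (1 + t * ((s ⬝ᵥ u) * (s ⬝ᵥ v)) + 5 / 4 * t ^ 2 *
        (Real.exp (3 / 8 * (s ⬝ᵥ u) ^ 2) + Real.exp (3 / 8 * (s ⬝ᵥ v) ^ 2))) :=
        Finset.sum_le_sum hpt
    _ = 2 ^ d + t * (2 ^ d * (u ⬝ᵥ v)) + 5 / 4 * t ^ 2 *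
        (∑ s ∈ signVectors d, Real.exp (3 / 8 * (s ⬝ᵥ u) ^ 2) +
          ∑ s ∈ signVectors d, Real.exp (3 / 8 * (s ⬝ᵥ v) ^ 2)) := by
        rw [Finset.sum_add_distrib, Finset.sum_add_distrib, ← Finset.mul_sum, ← Finset.mul_sum,
          Finset.sum_add_distrib, sum_signVectors_dotProduct_mul_dotProduct, Finset.sum_const,
          card_signVectors]
        simp
    _ ≤ 2 ^ d + t * (2 ^ d * (u ⬝ᵥ v)) + 5 / 4 * t ^ 2 * (2 ^ d * 2 + 2 ^ d * 2) := by gcongr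
    _ = 2 ^ d * (t * (u ⬝ᵥ v) + 5 * t ^ 2 + 1) := by ring
    _ ≤ _ := by
        gcongr
        exact Real.add_one_le_exp _

/-! ### Johnson–Lindenstrauss by a greedy choice of signs -/

/-- Choosing sign vectors one by one so that an exponential potential stays small. -/
theorem exists_sum_exp_le {κ : Type*} [Fintype κ] {d : ℕ} (u v : κ → Fin d → ℝ)
    (hu : ∀ p, u p ⬝ᵥ u p = 1) (hv : ∀ p, v p ⬝ᵥ v p = 1) {t : ℝ} (ht : |t| ≤ 1 / 24) (m : ℕ) :
    ∃ s : ℕ → Fin d → ℝ,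
      ∑ p, Real.exp (t * ∑ k ∈ Finset.range m, ((s k ⬝ᵥ u p) * (s k ⬝ᵥ v p) - u p ⬝ᵥ v p)) ≤
        Fintype.card κ * Real.exp (m * (5 * t ^ 2)) := by
  induction m with
  | zero => exact ⟨0, by simp⟩
  | succ m ih =>
    obtain ⟨s, hs⟩ := ih
    set W : κ → ℝ := fun p =>
      Real.exp (t * ∑ k ∈ Finset.range m, ((s k ⬝ᵥ u p) * (s k ⬝ᵥ v p) - u p ⬝ᵥ v p)) with hW
    have hW0 : ∀ p, 0 ≤ W p := fun p => (Real.exp_pos _).le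
    -- On average over the next sign vector the potential grows by at most `exp (5 * t ^ 2)`, so
    -- some choice does no worse.
    have havg : ∑ x ∈ signVectors d,
        ∑ p, W p * Real.exp (t * ((x ⬝ᵥ u p) * (x ⬝ᵥ v p) - u p ⬝ᵥ v p)) ≤
        ∑ x ∈ signVectors d, (∑ p, W p) * Real.exp (5 * t ^ 2) := by
      rw [Finset.sum_comm, Finset.sum_const, card_signVectors, nsmul_eq_mul, Finset.sum_mul,
        Finset.mul_sum]
      refine Finset.sum_le_sum fun p _ => ?_
      have h := sum_signVectors_exp_mul_le (hu p) (hv p) ht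
      have h1 : ∑ x ∈ signVectors d, Real.exp (t * ((x ⬝ᵥ u p) * (x ⬝ᵥ v p) - u p ⬝ᵥ v p)) ≤
          2 ^ d * Real.exp (5 * t ^ 2) := by
        calc _ = (∑ x ∈ signVectors d, Real.exp (t * ((x ⬝ᵥ u p) * (x ⬝ᵥ v p)))) *
              Real.exp (-(t * (u p ⬝ᵥ v p))) := by
              rw [Finset.sum_mul]
              refine Finset.sum_congr rfl fun x _ => ?_
              rw [← Real.exp_add]
              congr 1
              ring
          _ ≤ 2 ^ d * Real.exp (t * (u p ⬝ᵥ v p) + 5 * t ^ 2) * Real.exp (-(t * (u p ⬝ᵥ v p))) :=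
              mul_le_mul_of_nonneg_right h (Real.exp_pos _).le
          _ = _ := by
              rw [mul_assoc, ← Real.exp_add]
              congr 2
              ring
      rw [← Finset.mul_sum]
      have h2 := mul_le_mul_of_nonneg_left h1 (hW0 p)
      push_cast
      linarith
    have hne : (signVectors d).Nonempty := by
      rw [← Finset.card_pos, card_signVectors]; positivity
    obtain ⟨x, _, hx⟩ := Finset.exists_le_of_sum_le hne havg
    refine ⟨fun k => if k = m then x else s k, ?_⟩
    have hsum : ∀ p, Real.exp (t * ∑ k ∈ Finset.range (m + 1),
        (((if k = m then x else s k) ⬝ᵥ u p) * ((if k = m then x else s k) ⬝ᵥ v p) - u p ⬝ᵥ v p)) =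
        W p * Real.exp (t * ((x ⬝ᵥ u p) * (x ⬝ᵥ v p) - u p ⬝ᵥ v p)) := by
      intro p
      rw [Finset.sum_range_succ, mul_add, Real.exp_add, hW]
      simp only [if_true]
      congr 3
      refine Finset.sum_congr rfl fun k hk => ?_
      rw [if_neg (Finset.mem_range.1 hk).ne]
    simp only [hsum]
    calc _ ≤ (∑ p, W p) * Real.exp (5 * t ^ 2) := hx
      _ ≤ Fintype.card κ * Real.exp (m * (5 * t ^ 2)) * Real.exp (5 * t ^ 2) :=
          mul_le_mul_of_nonneg_right hs (Real.exp_pos _).le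
      _ = _ := by
          rw [mul_assoc, ← Real.exp_add]
          congr 2
          push_cast
          ring

/-- A Johnson–Lindenstrauss lemma for the pairwise inner products of unit vectors. -/
theorem exists_dotProduct_approx {ι : Type*} [Fintype ι] {d m : ℕ} (v : ι → Fin d → ℝ)
    (hv : ∀ p, v p ⬝ᵥ v p = 1) {δ : ℝ} (hδ : 0 < δ) (hδ' : δ ≤ 5 / 12) (hm : 0 < m)
    (hcard : 2 * (Fintype.card ι : ℝ) ^ 2 < Real.exp (m * δ ^ 2 / 20)) :
    ∃ w : ι → Fin m → ℝ, ∀ p q, |w p ⬝ᵥ w q - v p ⬝ᵥ v q| ≤ δ := by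
  -- `t = δ / 10` minimises `5 * t ^ 2 - t * δ`, with value `-δ ^ 2 / 20`.
  have ht : |δ / 10| ≤ 1 / 24 := by rw [abs_of_pos (by positivity)]; linarith
  -- Each pair also enters with its second vector negated, so that upper bounds alone give two-sided
  -- ones.
  obtain ⟨s, hs⟩ := exists_sum_exp_le (κ := (ι × ι) ⊕ (ι × ι))
    (Sum.elim (fun p : ι × ι => v p.1) (fun p : ι × ι => v p.1)) (Sum.elim (fun p : ι × ι => v p.2) (fun p : ι × ι => -v p.2))
    (by rintro (p | p) <;> simp [hv]) (by rintro (p | p) <;> simp [hv]) ht m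
  have hm' : (0 : ℝ) < m := by exact_mod_cast hm
  have hbound : ∀ p, ∑ k ∈ Finset.range m,
      ((s k ⬝ᵥ Sum.elim (fun p : ι × ι => v p.1) (fun p : ι × ι => v p.1) p) *
        (s k ⬝ᵥ Sum.elim (fun p : ι × ι => v p.2) (fun p : ι × ι => -v p.2) p) -
        Sum.elim (fun p : ι × ι => v p.1) (fun p : ι × ι => v p.1) p ⬝ᵥ
        Sum.elim (fun p : ι × ι => v p.2) (fun p : ι × ι => -v p.2) p) ≤ m * δ := by
    intro p
    by_contra! hlt
    have h1 := (Finset.single_le_sum (fun q _ => (Real.exp_pos _).le) (Finset.mem_univ p)).trans hs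
    have h2 := Real.exp_le_exp.2 (mul_le_mul_of_nonneg_left hlt.le (by positivity : 0 ≤ δ / 10))
    have h3 : Real.exp (δ / 10 * (m * δ)) =
        Real.exp (m * δ ^ 2 / 20) * Real.exp (m * (5 * (δ / 10) ^ 2)) := by
      rw [← Real.exp_add]
      congr 1
      ring
    have h4 : ((Fintype.card ((ι × ι) ⊕ (ι × ι)) : ℕ) : ℝ) = 2 * (Fintype.card ι : ℝ) ^ 2 := by
      simp
      ring
    rw [h4] at h1
    have h5 := mul_lt_mul_of_pos_right hcard (Real.exp_pos (m * (5 * (δ / 10) ^ 2)))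
    linarith
  refine ⟨fun p k => (s k ⬝ᵥ v p) / √m, fun p q => ?_⟩
  have hw : (fun k : Fin m => (s k ⬝ᵥ v p) / √(m : ℝ)) ⬝ᵥ (fun k : Fin m => (s k ⬝ᵥ v q) / √(m : ℝ)) -
      v p ⬝ᵥ v q =
      (∑ k ∈ Finset.range m, ((s k ⬝ᵥ v p) * (s k ⬝ᵥ v q) - v p ⬝ᵥ v q)) / m := by
    rw [Finset.sum_sub_distrib, Finset.sum_const, Finset.card_range, nsmul_eq_mul, sub_div,
      mul_div_cancel_left₀ _ hm'.ne', dotProduct,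
      Finset.sum_range (fun k => (s k ⬝ᵥ v p) * (s k ⬝ᵥ v q)), Finset.sum_div]
    congr 1
    refine Finset.sum_congr rfl fun k _ => ?_
    rw [div_mul_div_comm, Real.mul_self_sqrt hm'.le]
  rw [hw, abs_div, abs_of_pos hm', div_le_iff₀ hm', mul_comm δ, abs_le]
  have h1 := hbound (Sum.inl (p, q))
  have h2 := hbound (Sum.inr (p, q))
  simp only [Sum.elim_inl, Sum.elim_inr, dotProduct_neg] at h1 h2
  refine ⟨?_, h1⟩
  have h3 : ∑ k ∈ Finset.range m, ((s k ⬝ᵥ v p) * -(s k ⬝ᵥ v q) - -(v p ⬝ᵥ v q)) =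
      -∑ k ∈ Finset.range m, ((s k ⬝ᵥ v p) * (s k ⬝ᵥ v q) - v p ⬝ᵥ v q) := by
    rw [← Finset.sum_neg_distrib]
    exact Finset.sum_congr rfl fun k _ => by ring
  rw [h3] at h2
  linarith

/-! ### Truncating the spectra -/

/-- Keeping only the large entries of a nonnegative vector of bounded sum. -/
theorem exists_card_le_and_sum_sq_compl_le {d k : ℕ} {c : Fin d → ℝ} (hc : ∀ a, 0 ≤ c a) {ℓ : ℝ}
    (hℓ : 0 < ℓ) (hsum : ∑ a, c a ≤ ℓ) (hk : 0 < k) :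
    ∃ S : Finset (Fin d), S.card ≤ k ∧ ∑ a ∈ Sᶜ, c a ^ 2 ≤ ℓ ^ 2 / k := by
  have hk' : (0 : ℝ) < k := by exact_mod_cast hk
  have hpos : 0 < ℓ / k := by positivity
  refine ⟨Finset.univ.filter fun a => ℓ / k < c a, ?_, ?_⟩
  · set S := Finset.univ.filter fun a => ℓ / k < c a
    have h1 : S.card • (ℓ / k) ≤ ∑ a ∈ S, c a :=
      Finset.card_nsmul_le_sum S _ _ fun a ha => (Finset.mem_filter.1 ha).2.le
    have h2 : ∑ a ∈ S, c a ≤ ∑ a, c a :=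
      Finset.sum_le_sum_of_subset_of_nonneg (Finset.subset_univ S) fun a _ _ => hc a
    have h3 : (S.card : ℝ) * (ℓ / k) ≤ k * (ℓ / k) := by
      rw [mul_div_cancel₀ _ hk'.ne', ← nsmul_eq_mul]
      linarith
    exact_mod_cast le_of_mul_le_mul_right h3 hpos
  · calc _ ≤ ∑ a ∈ (Finset.univ.filter fun a => ℓ / k < c a)ᶜ, ℓ / k * c a := by
          refine Finset.sum_le_sum fun a ha => ?_
          rw [sq]
          refine mul_le_mul_of_nonneg_right ?_ (hc a)
          simpa using ha
      _ ≤ ∑ a, ℓ / k * c a :=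
          Finset.sum_le_sum_of_subset_of_nonneg (Finset.subset_univ _)
            fun a _ _ => mul_nonneg hpos.le (hc a)
      _ = ℓ / k * ∑ a, c a := by rw [Finset.mul_sum]
      _ ≤ ℓ / k * ℓ := mul_le_mul_of_nonneg_left hsum hpos.le
      _ = ℓ ^ 2 / k := by ring

/-- Restricting a bilinear form with doubly substochastic weights to large coordinates. -/
theorem abs_sum_sum_sub_sum_sum_lt {α β : Type*} [Fintype α] [Fintype β] [DecidableEq α]
    [DecidableEq β] {x : α → ℝ} {y : β → ℝ} {c : α → β → ℝ} (hc : ∀ a b, 0 ≤ c a b)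
    (hrow : ∀ a, ∑ b, c a b ≤ 1) (hcol : ∀ b, ∑ a, c a b ≤ 1) {S : Finset α} {T : Finset β}
    {R L η : ℝ} (hR : 0 ≤ R) (hL : 0 ≤ L) (hx : ∑ a, x a ^ 2 ≤ L) (hy : ∑ b, y b ^ 2 ≤ L)
    (hxS : ∑ a ∈ Sᶜ, x a ^ 2 ≤ R) (hyT : ∑ b ∈ Tᶜ, y b ^ 2 ≤ R) (hη : 0 < η)
    (h : 4 * R * L < η ^ 2) :
    |∑ a, ∑ b, x a * y b * c a b - ∑ a ∈ S, ∑ b ∈ T, x a * y b * c a b| < η := by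
  have hrow' : ∀ (T : Finset β), ∀ a, ∑ b ∈ T, c a b ≤ 1 := fun T a =>
    (Finset.sum_le_sum_of_subset_of_nonneg (Finset.subset_univ T) fun b _ _ => hc a b).trans
      (hrow a)
  have hcol' : ∀ (S : Finset α), ∀ b, ∑ a ∈ S, c a b ≤ 1 := fun S b =>
    (Finset.sum_le_sum_of_subset_of_nonneg (Finset.subset_univ S) fun a _ _ => hc a b).trans
      (hcol b)
  have hX := sq_sum_sum_mul_le (s := Sᶜ) (t := Finset.univ) (x := x) (y := y) hc
    (fun a _ => hrow' _ a) (fun b _ => hcol' _ b)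
  have hY := sq_sum_sum_mul_le (s := S) (t := Tᶜ) (x := x) (y := y) hc
    (fun a _ => hrow' _ a) (fun b _ => hcol' _ b)
  have hxS' : ∑ a ∈ S, x a ^ 2 ≤ L :=
    (Finset.sum_le_sum_of_subset_of_nonneg (Finset.subset_univ S) fun a _ _ => sq_nonneg _).trans hx
  -- The complement of `S × T` is the disjoint union of `Sᶜ × univ` and `S × Tᶜ`; each part
  -- contributes at most `√(R * L) < η / 2`.
  have hsplit : ∑ a, ∑ b, x a * y b * c a b - ∑ a ∈ S, ∑ b ∈ T, x a * y b * c a b =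
      ∑ a ∈ Sᶜ, ∑ b, x a * y b * c a b + ∑ a ∈ S, ∑ b ∈ Tᶜ, x a * y b * c a b := by
    rw [← Finset.sum_add_sum_compl S fun a => ∑ b, x a * y b * c a b]
    have : ∑ a ∈ S, ∑ b, x a * y b * c a b =
        ∑ a ∈ S, ∑ b ∈ T, x a * y b * c a b + ∑ a ∈ S, ∑ b ∈ Tᶜ, x a * y b * c a b := by
      rw [← Finset.sum_add_distrib]
      exact Finset.sum_congr rfl fun a _ => (Finset.sum_add_sum_compl T _).symm
    rw [this]
    ring
  have hX2 := hX.trans (mul_le_mul hxS hy (Finset.sum_nonneg fun _ _ => sq_nonneg _) hR)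
  have hY2 := hY.trans (mul_le_mul hxS' hyT (Finset.sum_nonneg fun _ _ => sq_nonneg _) hL)
  rw [hsplit]
  have hX3 := abs_lt_of_sq_lt_sq (hX2.trans_lt (by nlinarith : R * L < (η / 2) ^ 2)) (by positivity)
  have hY3 := abs_lt_of_sq_lt_sq (hY2.trans_lt (by nlinarith : L * R < (η / 2) ^ 2)) (by positivity)
  exact (abs_add_le _ _).trans_lt (by linarith)

theorem abs_dotProduct_le_one {d : ℕ} {u v : Fin d → ℝ} (hu : u ⬝ᵥ u = 1) (hv : v ⬝ᵥ v = 1) :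
    |u ⬝ᵥ v| ≤ 1 := by
  rw [← sq_le_one_iff_abs_le_one]
  have := Finset.sum_mul_sq_le_sq_mul_sq Finset.univ u v
  simp only [dotProduct, ← sq] at *
  rwa [hu, hv, mul_one] at this

/-- Truncate the spectra of a Gram representation and move the remaining eigenvectors to a
space of dimension `D` where they approximately keep their inner products. -/
theorem exists_cpsdRank_le_and_abs_sub_lt {n d k D : ℕ} {M : Matrix (Fin n) (Fin n) ℝ}
    {A : Fin n → Matrix (Fin d) (Fin d) ℝ} (hA : IsPsdGramRep M A) {ℓ L η δ : ℝ} (hℓ : 0 < ℓ)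
    (hL : 0 ≤ L) (htr : ∀ i, (A i).trace ≤ ℓ) (hdiag : ∀ i, M i i ≤ L) (hk : 0 < k) (hη : 0 < η)
    (h : 4 * (ℓ ^ 2 / k) * L < η ^ 2) (hD : 1 ≤ D) (hδ : 0 ≤ δ)
    (hw : ∀ P : Finset (Fin n × Fin d), P.card ≤ n * k → ∀ v : P → Fin d → ℝ,
      (∀ p, v p ⬝ᵥ v p = 1) → ∃ w : P → Fin D → ℝ, ∀ p q, |w p ⬝ᵥ w q - v p ⬝ᵥ v q| ≤ δ) :
    ∃ N : Matrix (Fin n) (Fin n) ℝ, IsCpsd N ∧ cpsdRank N ≤ D ∧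
      ∀ i j, |M i j - N i j| < η + ℓ ^ 2 * (δ * (2 + δ)) := by
  choose c u hc hu hpars hAeq using fun i => (hA.1 i).exists_eq_sum_vecMulVec
  have hsum : ∀ i, ∑ a, c i a ≤ ℓ := by
    intro i
    rw [← trace_sum_smul_vecMulVec Finset.univ (c i) (hu i), ← hAeq i]
    exact htr i
  choose S hScard hSsum using fun i => exists_card_le_and_sum_sq_compl_le (hc i) hℓ (hsum i) hk
  have hM : ∀ i j, M i j = ∑ a, ∑ b, c i a * c j b * (u i a ⬝ᵥ u j b) ^ 2 := by
    intro i j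
    rw [hA.2 i j, hAeq i, hAeq j, traceInner_sum_smul_vecMulVec]
  have hrow : ∀ i j a, ∑ b, (u i a ⬝ᵥ u j b) ^ 2 = 1 := by
    intro i j a
    simp_rw [dotProduct_comm (u i a)]
    rw [hpars, hu]
  have hcol : ∀ i j b, ∑ a, (u i a ⬝ᵥ u j b) ^ 2 = 1 := by
    intro i j b
    rw [hpars, hu]
  -- The squares are the terms `a = b` of the nonnegative double sum for `M i i`.
  have hcsq : ∀ i, ∑ a, c i a ^ 2 ≤ L := by
    intro i
    refine le_trans ?_ (hdiag i)
    rw [hM i i]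
    refine Finset.sum_le_sum fun a _ => ?_
    have := Finset.single_le_sum (f := fun b => c i a * c i b * (u i a ⬝ᵥ u i b) ^ 2)
      (fun b _ => mul_nonneg (mul_nonneg (hc i a) (hc i b)) (sq_nonneg _)) (Finset.mem_univ a)
    simpa [hu, sq] using this
  set P : Finset (Fin n × Fin d) := Finset.univ.filter fun p => p.2 ∈ S p.1 with hP
  have hPcard : P.card ≤ n * k := by
    have h1 : P.card = ∑ i, (S i).card := by
      rw [hP, ← Finset.univ_product_univ, Finset.card_filter, Finset.sum_product]
      simp
    rw [h1]
    calc ∑ i, (S i).card ≤ ∑ _i : Fin n, k := Finset.sum_le_sum fun i _ => hScard i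
      _ = n * k := by simp
  obtain ⟨w, hw⟩ := hw P hPcard (fun p => u p.1.1 p.1.2) fun p => hu _ _
  set z : Fin n → Fin d → Fin D → ℝ := fun i a => if hp : (i, a) ∈ P then w ⟨(i, a), hp⟩ else 0
    with hz
  have hzw : ∀ i j, ∀ a ∈ S i, ∀ b ∈ S j, |z i a ⬝ᵥ z j b - u i a ⬝ᵥ u j b| ≤ δ := by
    intro i j a ha b hb
    have h1 : (i, a) ∈ P := by simpa [hP] using ha
    have h2 : (j, b) ∈ P := by simpa [hP] using hb
    rw [hz]
    simp only [h1, h2, dif_pos]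
    exact hw ⟨(i, a), h1⟩ ⟨(j, b), h2⟩
  set B : Fin n → Matrix (Fin D) (Fin D) ℝ := fun i =>
    ∑ a ∈ S i, c i a • Matrix.vecMulVec (z i a) (z i a) with hB
  have hrep : IsPsdGramRep (Matrix.of fun i j => traceInner (B i) (B j)) B :=
    ⟨fun i => posSemidef_sum_smul_vecMulVec _ (hc i) _, fun i j => rfl⟩
  refine ⟨Matrix.of fun i j => traceInner (B i) (B j), ⟨D, hD, B, hrep⟩,
    Nat.sInf_le ⟨hD, B, hrep⟩, fun i j => ?_⟩
  have h1 := abs_sum_sum_sub_sum_sum_lt (x := c i) (y := c j)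
    (c := fun a b => (u i a ⬝ᵥ u j b) ^ 2) (S := S i) (T := S j) (fun a b => sq_nonneg _)
    (fun a => (hrow i j a).le) (fun b => (hcol i j b).le) (by positivity) hL (hcsq i) (hcsq j)
    (hSsum i) (hSsum j) hη h
  rw [← hM i j] at h1
  have hterm : ∀ a ∈ S i, ∀ b ∈ S j,
      |c i a * c j b * (u i a ⬝ᵥ u j b) ^ 2 - c i a * c j b * (z i a ⬝ᵥ z j b) ^ 2| ≤
        c i a * c j b * (δ * (2 + δ)) := by
    intro a ha b hb
    rw [← mul_sub, abs_mul, abs_of_nonneg (mul_nonneg (hc i a) (hc j b))]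
    refine mul_le_mul_of_nonneg_left ?_ (mul_nonneg (hc i a) (hc j b))
    have h3 := hzw i j a ha b hb
    have h4 := abs_dotProduct_le_one (hu i a) (hu j b)
    generalize z i a ⬝ᵥ z j b = g at *
    generalize u i a ⬝ᵥ u j b = r at *
    have h5 : r ^ 2 - g ^ 2 = -((g - r) * (2 * r + (g - r))) := by ring
    rw [h5, abs_neg, abs_mul]
    refine mul_le_mul h3 ?_ (abs_nonneg _) hδ
    refine (abs_add_le _ _).trans ?_
    rw [abs_mul, abs_two]
    linarith
  have hnn : ∀ T : Finset (Fin d), ∀ i, 0 ≤ ∑ a ∈ T, c i a := fun T i =>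
    Finset.sum_nonneg fun a _ => hc i a
  have hle : ∀ i, ∑ a ∈ S i, c i a ≤ ℓ := fun i =>
    (Finset.sum_le_sum_of_subset_of_nonneg (Finset.subset_univ _) fun a _ _ => hc i a).trans
      (hsum i)
  have h2 : |∑ a ∈ S i, ∑ b ∈ S j, c i a * c j b * (u i a ⬝ᵥ u j b) ^ 2 -
      traceInner (B i) (B j)| ≤ ℓ ^ 2 * (δ * (2 + δ)) := by
    rw [hB, traceInner_sum_smul_vecMulVec]
    simp_rw [← Finset.sum_sub_distrib]
    calc _ ≤ ∑ a ∈ S i, ∑ b ∈ S j, c i a * c j b * (δ * (2 + δ)) := by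
          refine (Finset.abs_sum_le_sum_abs _ _).trans (Finset.sum_le_sum fun a ha => ?_)
          exact (Finset.abs_sum_le_sum_abs _ _).trans (Finset.sum_le_sum fun b hb => hterm a ha b hb)
      _ = (∑ a ∈ S i, c i a) * (∑ b ∈ S j, c j b) * (δ * (2 + δ)) := by
          rw [Finset.sum_mul_sum, Finset.sum_mul]
          simp_rw [Finset.sum_mul]
      _ ≤ ℓ * ℓ * (δ * (2 + δ)) := by
          refine mul_le_mul_of_nonneg_right ?_ (by positivity)
          exact mul_le_mul (hle i) (hle j) (hnn _ _) hℓ.le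
      _ = _ := by ring
  exact (abs_sub_le _ _ _).trans_lt (add_lt_add_of_lt_of_le h1 h2)

/-! ### Choice of the parameters -/

theorem theorem3p1 {n d : ℕ} (hd : 1 ≤ d) (M : Matrix (Fin n) (Fin n) ℝ)
    (A : Fin n → Matrix (Fin d) (Fin d) ℝ) (hA : IsPsdGramRep M A) (ℓ L : ℝ)
    (hℓ : IsGreatest (Set.range fun i => (A i).trace) ℓ)
    (hL : IsGreatest (Set.range fun i => M i i) L)
    (ε : ℝ) (hε : 0 < ε) (hε' : ε < 1 / 2 * min (ℓ ^ 2) L) :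
    ∃ N : Matrix (Fin n) (Fin n) ℝ, IsCpsd N ∧
      (cpsdRank N : ℝ) ≤
        min ((n : ℝ) * (⌈9 * L * ℓ ^ 2 / (2 * ε ^ 2)⌉ : ℝ))
          ((6 * ℓ) ^ 4 * Real.log ((n : ℝ) * (⌈18 * L * ℓ ^ 2 / ε ^ 2⌉ : ℝ) + 1) / ε ^ 2) ∧
      ∀ i j, |M i j - N i j| < ε := by
  have htr : ∀ i, (A i).trace ≤ ℓ := fun i => hℓ.2 ⟨i, rfl⟩
  have hdiag : ∀ i, M i i ≤ L := fun i => hL.2 ⟨i, rfl⟩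
  have hεℓ : 2 * ε < ℓ ^ 2 := by linarith [min_le_left (ℓ ^ 2) L]
  have hεL : 2 * ε < L := by linarith [min_le_right (ℓ ^ 2) L]
  have hL0 : 0 < L := by linarith
  obtain ⟨i₀, hi₀⟩ := hℓ.1
  have hn : 1 ≤ n := Fin.pos i₀
  have hn' : (1 : ℝ) ≤ n := by exact_mod_cast hn
  have hℓ0 : 0 < ℓ := by
    have h1 : 0 ≤ ℓ := hi₀ ▸ (hA.1 i₀).trace_nonneg
    rcases h1.lt_or_eq with h2 | h2
    · exact h2
    · rw [← h2] at hεℓ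
      linarith
  have hceil : ∀ x : ℝ, 0 < x → ∃ k : ℕ, 0 < k ∧ (⌈x⌉ : ℝ) = k ∧ x ≤ k := by
    intro x hx
    refine ⟨⌈x⌉₊, Nat.ceil_pos.2 hx, ?_, Nat.le_ceil x⟩
    exact (natCast_ceil_eq_intCast_ceil hx.le).symm
  have hsmall : ∀ (C : ℝ) (k : ℕ), 0 < k → C * (L * ℓ ^ 2 / ε ^ 2) ≤ k →
      C * (ℓ ^ 2 / k * L) ≤ ε ^ 2 := by
    intro C k hk hCk
    have hk' : (0 : ℝ) < k := by exact_mod_cast hk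
    have h1 := mul_le_mul_of_nonneg_right hCk (by positivity : 0 ≤ ε ^ 2 / k)
    calc C * (ℓ ^ 2 / k * L) = C * (L * ℓ ^ 2 / ε ^ 2) * (ε ^ 2 / k) := by field_simp
      _ ≤ k * (ε ^ 2 / k) := h1
      _ = ε ^ 2 := by field_simp
  have e1 : 9 * L * ℓ ^ 2 / (2 * ε ^ 2) = 9 / 2 * (L * ℓ ^ 2 / ε ^ 2) := by ring
  have e2 : 18 * L * ℓ ^ 2 / ε ^ 2 = 18 * (L * ℓ ^ 2 / ε ^ 2) := by ring
  rw [e1, e2]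
  obtain ⟨k, hk0, hkc, hk⟩ := hceil (9 / 2 * (L * ℓ ^ 2 / ε ^ 2)) (by positivity)
  obtain ⟨r, hr0, hrc, hr⟩ := hceil (18 * (L * ℓ ^ 2 / ε ^ 2)) (by positivity)
  rw [hkc, hrc]
  rcases min_choice ((n : ℝ) * k) ((6 * ℓ) ^ 4 * Real.log ((n : ℝ) * r + 1) / ε ^ 2) with hmin | hmin
  · rw [hmin]
    -- The move is isometric, so truncation may use all of `ε`: `4 * ℓ ^ 2 * L / k ≤ 8 / 9 * ε ^ 2`.
    obtain ⟨N, hN, hrank, hclose⟩ := exists_cpsdRank_le_and_abs_sub_lt (D := n * k) (δ := 0) hA hℓ0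
      hL0.le htr hdiag hk0 hε (by linarith [hsmall _ k hk0 hk, sq_pos_of_pos hε]) (Nat.mul_pos hn hk0) le_rfl
      (fun P hP v _ => by
        obtain ⟨w, hw⟩ := exists_dotProduct_eq v (by simpa using hP : Fintype.card P ≤ n * k)
        exact ⟨w, fun p q => by rw [hw, sub_self, abs_zero]⟩)
    exact ⟨N, hN, by exact_mod_cast hrank, by simpa using hclose⟩
  · rw [hmin]
    set X : ℝ := n * r with hX
    have hrr : 18 ≤ (r : ℝ) := by
      have h1 : 1 ≤ L * ℓ ^ 2 / ε ^ 2 := by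
        rw [one_le_div (by positivity), sq ε]
        exact mul_le_mul (by linarith) (by linarith) hε.le hL0.le
      linarith
    have hX1 : 18 ≤ X := by nlinarith
    have hlog : 1 ≤ Real.log (X + 1) := by
      rw [Real.le_log_iff_exp_le (by linarith)]
      linarith [Real.exp_one_lt_d9]
    set T : ℝ := (6 * ℓ) ^ 4 * Real.log (X + 1) / ε ^ 2 with hT
    have hq : 4 ≤ ℓ ^ 4 / ε ^ 2 := by
      rw [le_div_iff₀ (by positivity)]
      calc 4 * ε ^ 2 = (2 * ε) ^ 2 := by ring
        _ ≤ (ℓ ^ 2) ^ 2 := pow_le_pow_left₀ (by positivity) hεℓ.le 2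
        _ = ℓ ^ 4 := by ring
    have hTe : T = 1296 * (ℓ ^ 4 / ε ^ 2) * Real.log (X + 1) := by rw [hT]; ring
    have hT1 : 1296 ≤ T := by
      rw [hTe]
      exact (by linarith : (1296 : ℝ) ≤ 1296 * (ℓ ^ 4 / ε ^ 2)).trans
        (le_mul_of_one_le_right (by positivity) hlog)
    have hm0 : 0 < ⌊T⌋₊ := Nat.floor_pos.2 (by linarith)
    have hmT : T - 1 < ⌊T⌋₊ := by linarith [Nat.lt_floor_add_one T]
    have hmT' : 9 / 10 * T ≤ ⌊T⌋₊ := by linarith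
    -- Since `δ ≤ 2 / 17`, the projection error is at most `4 / 17 * (36 / 17) * ε = 144 / 289 * ε`,
    -- just below `ε / 2`.
    set δ : ℝ := 4 * ε / (17 * ℓ ^ 2) with hδ
    have hδ0 : 0 < δ := by positivity
    have hδ1 : δ ≤ 2 / 17 := by
      rw [hδ, div_le_div_iff₀ (by positivity) (by norm_num)]
      linarith
    have hδℓ : ℓ ^ 2 * (δ * (2 + δ)) ≤ ε / 2 := by
      have h1 : ℓ ^ 2 * δ = 4 * ε / 17 := by rw [hδ]; field_simp
      rw [← mul_assoc, h1]
      nlinarith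
    -- Here `9 / 10 * 1296 * (16 / 289) / 20 > 3`; the factor `3` suffices because `2 * X ^ 2 < (X +
    -- 1) ^ 3`.
    have hexp : 3 * Real.log (X + 1) ≤ ⌊T⌋₊ * δ ^ 2 / 20 := by
      have h1 : ℓ ^ 4 / ε ^ 2 * δ ^ 2 = 16 / 289 := by
        rw [hδ]
        field_simp
        norm_num
      have h2 := mul_le_mul_of_nonneg_right hmT' (sq_nonneg δ)
      have h3 : 9 / 10 * T * δ ^ 2 = 9 / 10 * 1296 * (16 / 289) * Real.log (X + 1) := by
        rw [hTe, ← h1]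
        ring
      rw [h3] at h2
      linarith
    have hcard : 2 * X ^ 2 < Real.exp (⌊T⌋₊ * δ ^ 2 / 20) := by
      refine lt_of_lt_of_le ?_ (Real.exp_le_exp.2 hexp)
      have h1 : Real.exp (3 * Real.log (X + 1)) = (X + 1) ^ 3 := by
        rw [show (3 : ℝ) = ((3 : ℕ) : ℝ) by norm_num, Real.exp_nat_mul,
          Real.exp_log (by linarith)]
      rw [h1]
      linarith [pow_nonneg (by linarith : 0 ≤ X) 3, sq_nonneg X,
        (by ring : (X + 1) ^ 3 = X ^ 3 + 3 * X ^ 2 + 3 * X + 1)]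
    -- Truncation gets the other half of `ε`: `4 * ℓ ^ 2 * L / r ≤ 2 / 9 * ε ^ 2 < (ε / 2) ^ 2`.
    obtain ⟨N, hN, hrank, hclose⟩ := exists_cpsdRank_le_and_abs_sub_lt (D := ⌊T⌋₊) (δ := δ)
      (η := ε / 2) hA hℓ0 hL0.le htr hdiag hr0 (by positivity)
      (by linarith [hsmall _ r hr0 hr, sq_pos_of_pos hε]) hm0 hδ0.le
      (fun P hP v hv => by
        refine exists_dotProduct_approx v hv hδ0 (by linarith) hm0 (lt_of_le_of_lt ?_ hcard)
        have h1 : (Fintype.card P : ℝ) ≤ X := by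
          rw [hX]
          exact_mod_cast (by simpa using hP : Fintype.card P ≤ n * r)
        gcongr)
    refine ⟨N, hN, ?_, fun i j => (hclose i j).trans_le (by linarith)⟩
    exact le_trans (by exact_mod_cast hrank) (Nat.floor_le (by linarith))
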